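/- Let $B$ be a (real) Banach lattice. A linear operator $Q$ on $B$ is called positive if $Qf\ge 0$ whenever $f\ge 0$; positive operators are bounded. For a bounded linear operator $Q$ on $B$ let $\|Q\|$ be its operator norm and $r(Q)$ its spectral radius (the largest modulus of a point of the spectrum of the complexification of $Q$, and $0$ if $B=\{0\}$). Its essential spectral radius is \[ r_{\mathrm{ess}}(Q):=\lim_{n\to\infty}\ \inf\bigl\{\|Q^n-K\|^{1/n} : K \text{ a compact operator on } B\bigr\}, \] and $Q$ is called quasi-compact if $r_{\mathrm{ess}}(Q)<r(Q)$. The positive part $Q_+$ is said to be well defined if for every $f\ge 0$ the supremum $Q_+f:=\sup\{Qg : g\in B,\ 0\le g\le f\}$ exists in $B$ and $f\mapsto Q_+f$ $(f\ge 0)$ is the restriction of a positive linear operator on $B$. **Theorem.** Let $P$, $K$ and $S$ be positive linear operators on $B$ such that $K$ is compact, the positive part $(P-S)_+$ is well defined, and $0\le P\le K+S$, that is, $0\le Pf\le Kf+Sf$ for all $f\in B$ with $f\ge 0$. Then \[ r_{\mathrm{ess}}(P)\le r(S). \] In particular, if $r(S)<r(P)$, then $P$ is quasi-compact. -/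

import Mathlib

open Filter Topology
open scoped ENNReal TensorProduct

noncomputable section

namespace BanachLatticeOperators

section Bounded

variable {B : Type*} [NormedAddCommGroup B] [NormedSpace ℝ B]

/-- The spectral radius of a bounded operator `Q` on a real Banach space `B`, i.e. the largest
modulus of a point of the spectrum of (the complexification of) `Q`.  The algebra
`ℂ ⊗[ℝ] (B →L[ℝ] B)` is the algebra of bounded complex-linear operators on the complexification
of `B`, and `1 ⊗ₜ Q` is the complexification of `Q`. -/
def specRadius (Q : B →L[ℝ] B) : ℝ≥0∞ :=
  spectralRadius ℂ ((1 : ℂ) ⊗ₜ[ℝ] Q)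

/-- The distance, in operator norm, from `Q` to the set of compact operators on `B`. -/
def distCompact (Q : B →L[ℝ] B) : ℝ≥0∞ :=
  ⨅ K : {K : B →L[ℝ] B // IsCompactOperator K}, ‖Q - K.1‖ₑ

/-- The essential spectral radius of `Q`: the limit as `n → ∞` of the infimum over all compact
operators `K` of `‖Q ^ n - K‖ ^ (1 / n)`.  The limit exists, see
`tendsto_essentialSpectralRadius`. -/
def essentialSpectralRadius (Q : B →L[ℝ] B) : ℝ≥0∞ :=
  limUnder atTop fun n : ℕ =>
    ⨅ K : {K : B →L[ℝ] B // IsCompactOperator K}, ‖Q ^ n - K.1‖ₑ ^ (1 / (n : ℝ))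

/-- `Q` is quasi-compact if its essential spectral radius is smaller than its spectral radius. -/
def IsQuasiCompact (Q : B →L[ℝ] B) : Prop :=
  essentialSpectralRadius Q < specRadius Q

theorem distCompact_ne_top (Q : B →L[ℝ] B) : distCompact Q ≠ ∞ := by
  refine ne_top_of_le_ne_top (b := ‖Q - 0‖ₑ) (by simp [enorm]) ?_
  exact iInf_le (fun K : {K : B →L[ℝ] B // IsCompactOperator K} => ‖Q - K.1‖ₑ)
    ⟨0, isCompactOperator_zero⟩

theorem distCompact_mul_le (Q R : B →L[ℝ] B) :
    distCompact (Q * R) ≤ distCompact Q * distCompact R := by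
  have key : ∀ K L : {K : B →L[ℝ] B // IsCompactOperator K},
      distCompact (Q * R) ≤ ‖Q - K.1‖ₑ * ‖R - L.1‖ₑ := by
    rintro ⟨K, hK⟩ ⟨L, hL⟩
    have hc : IsCompactOperator (Q * L + K * R - K * L : B →L[ℝ] B) :=
      ((hL.clm_comp Q).add (hK.comp_clm R)).sub (hK.comp_clm L)
    refine (iInf_le _ (⟨_, hc⟩ : {K : B →L[ℝ] B // IsCompactOperator K})).trans ?_
    have h : Q * R - (Q * L + K * R - K * L) = (Q - K) * (R - L) := by noncomm_ring
    simp only [h]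
    simp only [enorm]
    exact_mod_cast nnnorm_mul_le (Q - K) (R - L)
  exact ENNReal.le_iInf_mul_iInf ⟨⟨0, isCompactOperator_zero⟩, by simp [enorm]⟩
    ⟨⟨0, isCompactOperator_zero⟩, by simp [enorm]⟩ key

theorem tendsto_root_of_submultiplicative (a : ℕ → ℝ≥0∞) (ha : ∀ n, a n ≠ ∞)
    (hmul : ∀ m n, a (m + n) ≤ a m * a n) :
    ∃ l, Tendsto (fun n : ℕ => a n ^ (1 / (n : ℝ))) atTop (𝓝 l) := by
  by_cases h0 : ∃ m, a m = 0
  · obtain ⟨m, hm⟩ := h0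
    refine ⟨0, tendsto_const_nhds.congr' ?_⟩
    filter_upwards [eventually_ge_atTop (m + 1)] with n hn
    have h : a n = 0 := by
      have := hmul m (n - m)
      rw [hm, zero_mul, Nat.add_sub_cancel' (by omega)] at this
      simpa using this
    have hn' : (0 : ℝ) < n := by exact_mod_cast (by omega : 0 < n)
    rw [h, ENNReal.zero_rpow_of_pos (by positivity)]
  · push Not at h0
    have hpos : ∀ n, 0 < (a n).toReal := fun n => ENNReal.toReal_pos (h0 n) (ha n)
    have hsub : Subadditive fun n => Real.log (a n).toReal := by
      intro m n
      show Real.log (a (m + n)).toReal ≤ Real.log (a m).toReal + Real.log (a n).toReal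
      rw [← Real.log_mul (hpos m).ne' (hpos n).ne', ← ENNReal.toReal_mul]
      exact Real.log_le_log (hpos _)
        (ENNReal.toReal_mono (ENNReal.mul_ne_top (ha m) (ha n)) (hmul m n))
    have hlt : ∀ (L : ℝ≥0∞) (n : ℕ), n ≠ 0 → L ≠ 0 → L ≠ ∞ →
        (a n ^ (1 / (n : ℝ)) < L ↔ Real.log (a n).toReal / n < Real.log L.toReal) := by
      intro L n hn hL0 hLt
      have hn' : (0 : ℝ) < n := by exact_mod_cast Nat.pos_of_ne_zero hn
      rw [← ENNReal.toReal_lt_toReal (ENNReal.rpow_ne_top_of_nonneg (by positivity) (ha n)) hLt,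
        ← ENNReal.toReal_rpow,
        ← Real.log_lt_log_iff (Real.rpow_pos_of_pos (hpos n) _) (ENNReal.toReal_pos hL0 hLt),
        Real.log_rpow (hpos n), one_div_mul_eq_div]
    refine ⟨⨅ n : {n : ℕ // n ≠ 0}, a n ^ (1 / ((n : ℕ) : ℝ)), tendsto_order.2 ⟨?_, ?_⟩⟩
    · intro l hl
      filter_upwards [eventually_ne_atTop 0] with n hn
      exact hl.trans_le (iInf_le (fun n : {n : ℕ // n ≠ 0} => a n ^ (1 / ((n : ℕ) : ℝ))) ⟨n, hn⟩)
    · intro L hL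
      obtain ⟨⟨n, hn⟩, hnL⟩ := iInf_lt_iff.1 hL
      obtain ⟨M, hnM, hML⟩ := exists_between hnL
      have hM0 : M ≠ 0 := (bot_le.trans_lt hnM).ne'
      have hMt : M ≠ ∞ := hML.ne_top
      filter_upwards [hsub.eventually_div_lt_of_div_lt hn ((hlt M n hn hM0 hMt).1 hnM),
        eventually_ne_atTop 0] with p hp hp0
      exact ((hlt M p hp0 hM0 hMt).2 hp).trans hML

/-- The limit in the definition of the essential spectral radius exists. -/
theorem tendsto_essentialSpectralRadius (Q : B →L[ℝ] B) :
    Tendsto (fun n : ℕ =>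
      ⨅ K : {K : B →L[ℝ] B // IsCompactOperator K}, ‖Q ^ n - K.1‖ₑ ^ (1 / (n : ℝ)))
      atTop (𝓝 (essentialSpectralRadius Q)) := by
  refine tendsto_nhds_limUnder ?_
  obtain ⟨l, hl⟩ := tendsto_root_of_submultiplicative (fun n => distCompact (Q ^ n))
    (fun n => distCompact_ne_top _) (fun m n => by rw [pow_add]; exact distCompact_mul_le _ _)
  refine ⟨l, hl.congr' ?_⟩
  filter_upwards [eventually_ne_atTop 0] with n hn
  have hn' : (0 : ℝ) < 1 / (n : ℝ) := by
    have : (0 : ℝ) < n := by exact_mod_cast Nat.pos_of_ne_zero hn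
    positivity
  exact (ENNReal.orderIsoRpow _ hn').map_iInf _

end Bounded

section Lattice

variable {B : Type*} [NormedAddCommGroup B] [NormedSpace ℝ B] [Lattice B]
  [IsOrderedAddMonoid B] [HasSolidNorm B]

/-- The positive part `Q₊` of the bounded operator `Q` is well defined: for every `f ≥ 0` the
supremum of `{Q g | 0 ≤ g ≤ f}` exists in `B`, and it is the value at `f` of a positive linear
operator on `B`. -/
def PositivePartWellDefined (Q : B →L[ℝ] B) : Prop :=
  ∃ T : B →ₚ[ℝ] B, ∀ f : B, 0 ≤ f → IsLUB {h | ∃ g : B, 0 ≤ g ∧ g ≤ f ∧ Q g = h} (T f)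

/-- A positive linear operator on a Banach lattice is bounded. -/
theorem continuous_of_positive [CompleteSpace B] [IsOrderedModule ℝ B] (T : B →ₚ[ℝ] B) :
    Continuous T := by
  suffices h : ∃ C : ℝ, ∀ x, ‖T x‖ ≤ C * ‖x‖ by
    obtain ⟨C, hC⟩ := h
    exact (T.toLinearMap.mkContinuous C hC).continuous
  by_contra! hcon
  have hstep : ∀ n : ℕ, ∃ y : B, 0 ≤ y ∧ ‖y‖ ≤ (1 / 2 : ℝ) ^ n ∧ (2 : ℝ) ^ n ≤ ‖T y‖ := by
    intro n
    obtain ⟨x, hx⟩ := hcon (4 ^ n)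
    have habs : ‖T x‖ ≤ ‖T |x|‖ := by
      refine norm_le_norm_of_abs_le_abs ?_
      rw [abs_of_nonneg (T.map_nonneg (abs_nonneg x))]
      refine abs_le'.2 ⟨OrderHomClass.mono T (le_abs_self x), ?_⟩
      rw [← map_neg]
      exact OrderHomClass.mono T (neg_le_abs x)
    have hx0 : 0 < ‖x‖ := by
      rcases (norm_nonneg x).eq_or_lt with h | h
      · have : x = 0 := norm_eq_zero.1 h.symm
        simp [this] at hx
      · exact h
    have h2 : (0 : ℝ) < 2 ^ n := by positivity
    have hc : (0 : ℝ) < (2 ^ n * ‖x‖)⁻¹ := by positivity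
    refine ⟨(2 ^ n * ‖x‖)⁻¹ • |x|, smul_nonneg hc.le (abs_nonneg x), ?_, ?_⟩
    · rw [norm_smul, norm_abs_eq_norm, Real.norm_of_nonneg hc.le, mul_inv, mul_assoc,
        inv_mul_cancel₀ hx0.ne', mul_one, one_div, inv_pow]
    · rw [map_smul, norm_smul, Real.norm_of_nonneg hc.le, inv_mul_eq_div, le_div_iff₀ (by positivity)]
      have h4 : (4 : ℝ) ^ n = 2 ^ n * 2 ^ n := by rw [← mul_pow]; norm_num
      rw [h4] at hx
      linarith
  choose y hy0 hy1 hy2 using hstep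
  have hsum : Summable y :=
    Summable.of_norm_bounded (summable_geometric_of_lt_one (by norm_num) (by norm_num)) hy1
  have hle : ∀ n, ‖T (y n)‖ ≤ ‖T (∑' i, y i)‖ := by
    intro n
    refine norm_le_norm_of_abs_le_abs ?_
    have h : y n ≤ ∑' i, y i := hsum.le_tsum n fun i _ => hy0 i
    rw [abs_of_nonneg (T.map_nonneg (hy0 n)),
      abs_of_nonneg (T.map_nonneg ((hy0 n).trans h))]
    exact OrderHomClass.mono T h
  obtain ⟨n, hn⟩ := pow_unbounded_of_one_lt ‖T (∑' i, y i)‖ (one_lt_two)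
  exact absurd (hn.trans_le (hy2 n)) (not_lt.2 (hle n))

/-- A positive linear operator on a Banach lattice, as a bounded operator. -/
def toBounded [CompleteSpace B] [IsOrderedModule ℝ B] (T : B →ₚ[ℝ] B) : B →L[ℝ] B :=
  ⟨T.toLinearMap, continuous_of_positive T⟩

end Lattice

end BanachLatticeOperators

end

/-! Put `R = (P - S)₊`. Then `0 ≤ R ≤ K`, `R ≤ P` and `0 ≤ P - R ≤ S`, so `P` is a sum of an
operator dominated by a compact one and an operator `S' = P - R` dominated by `S`. Expand `(R + S')
^ n` into words. Words with at least three factors `R` are compact. Words with at most two have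
total norm `O(r ^ n)` for every `r > r(S)`: their number is polynomial in `n`, and `‖S' ^ n‖ ≤ ‖S ^
n‖`. Hence the essential spectral radius of `P` is at most `r(S)`.

Compactness of the long words rests on the Aliprantis–Burkinshaw theorem on products of three
operators dominated by compact ones (`isCompactOperator_mul_mul_of_dominated`). The first factor
sends the ball near an order interval `[0, u] - v`, the third is controlled by a seminorm `φ |·|`,
and the middle one maps `[0, u]` to a totally bounded set for that seminorm
(`exists_coloring_of_dominated`). The last fact comes from an energy-increment argument
(`exists_regular_decomposition`): after cutting `u` and `φ` into finitely many pieces, `S` acts on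
each cell almost as a scalar multiple of `T`, so total boundedness passes from `T` to `S`. -/

namespace BanachLatticeOperators

/-! ### Hahn–Banach and Riesz decomposition. -/

section Decomposition

/-- A sublinear functional is attained at every point by a linear functional below it. -/
theorem exists_linearMap_eq_le_sublinear {E : Type*} [AddCommGroup E] [Module ℝ E] (p : E → ℝ)
    (hsmul : ∀ c : ℝ, 0 < c → ∀ x, p (c • x) = c * p x) (hadd : ∀ x y, p (x + y) ≤ p x + p y)
    (y : E) : ∃ g : E →ₗ[ℝ] ℝ, g y = p y ∧ ∀ x, g x ≤ p x := by
  have h0 : p 0 = 0 := by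
    have := hsmul 2 two_pos 0
    rw [smul_zero] at this
    linarith
  by_cases hy : y = 0
  · obtain ⟨g, -, hg⟩ := exists_extension_of_le_sublinear (⊥ : E →ₗ.[ℝ] ℝ) p hsmul hadd (by
      rintro ⟨x, hx⟩
      obtain rfl : x = 0 := (Submodule.mem_bot ℝ).1 hx
      exact (LinearPMap.map_zero _).trans_le h0.ge)
    exact ⟨g, by rw [hy, map_zero, h0], hg⟩
  · obtain ⟨g, hgy, hg⟩ := exists_extension_of_le_sublinear
      (LinearPMap.mkSpanSingleton (K := ℝ) y (p y) hy) p hsmul hadd (by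
        rintro ⟨x, hx⟩
        obtain ⟨c, rfl⟩ := Submodule.mem_span_singleton.1 hx
        have hv : LinearPMap.mkSpanSingleton (K := ℝ) y (p y) hy ⟨c • y, hx⟩ = c * p y :=
          LinearPMap.mkSpanSingleton'_apply y (p y) _ c hx
        rw [hv]
        rcases lt_trichotomy c 0 with hc | rfl | hc
        -- For `c < 0`, subadditivity and `p 0 = 0` give `p (c • y) ≥ -p (-c • y) = c * p y`.
        · have h1 := hadd (c • y) ((-c) • y)
          rw [← add_smul, add_neg_cancel, zero_smul, h0, hsmul (-c) (by linarith)] at h1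
          change c * p y ≤ p (c • y)
          linarith
        · simp [h0]
        · simp [hsmul c hc])
    refine ⟨g, ?_, hg⟩
    have h := hgy ⟨y, Submodule.mem_span_singleton_self y⟩
    rw [h]
    exact LinearPMap.mkSpanSingleton_apply ℝ ℝ hy (p y)

/-- The Riesz decomposition property for finite sums. -/
theorem exists_sum_eq_of_le_sum {B ι : Type*} [AddCommGroup B] [Lattice B] [IsOrderedAddMonoid B]
    (s : Finset ι) {a : ι → B} (ha : ∀ i, 0 ≤ a i) {x : B} (hx0 : 0 ≤ x)
    (hx : x ≤ ∑ i ∈ s, a i) :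
    ∃ y : ι → B, (∀ i, 0 ≤ y i ∧ y i ≤ a i) ∧ ∑ i ∈ s, y i = x := by
  classical
  induction s using Finset.induction_on generalizing x with
  | empty =>
    refine ⟨0, fun i => ⟨le_rfl, ha i⟩, ?_⟩
    simp only [Finset.sum_empty] at hx ⊢
    exact le_antisymm hx0 hx
  | insert j s hj ih =>
    rw [Finset.sum_insert hj] at hx
    -- The piece below `a j` is `x ⊓ a j`; what remains is `(x - a j)⁺`, which lies below the sum of
    -- the other `a i`.
    obtain ⟨y, hy, hys⟩ := ih (x := x - x ⊓ a j) (sub_nonneg.2 inf_le_left) (by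
      rw [sub_le_iff_le_add, ← sub_le_iff_le_add', le_inf_iff]
      exact ⟨sub_le_self _ (Finset.sum_nonneg fun i _ => ha i), sub_le_iff_le_add.2 hx⟩)
    refine ⟨Function.update y j (x ⊓ a j), fun i => ?_, ?_⟩
    · by_cases h : i = j
      · subst h
        simp [hx0, ha i]
      · simpa [h] using hy i
    · rw [Finset.sum_insert hj, Function.update_self,
        Finset.sum_congr rfl fun i hi => Function.update_of_ne (ne_of_mem_of_not_mem hi hj) _ y,
        hys]
      abel

end Decomposition

/-! ### Energy increment: a dominated operator is nearly a multiple of `T` on cells. -/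

section Regularity

/-- Degenerate cells cause no trouble: `t = 0` forces `s = 0`, and both sides vanish because
division by zero gives `0`. -/
theorem sq_sub_mul_div_eq {s t : ℝ} (h0 : 0 ≤ s) (h1 : s ≤ t) (c : ℝ) :
    (s - c * t) ^ 2 / t = s ^ 2 / t - 2 * c * s + c ^ 2 * t := by
  rcases (h0.trans h1).eq_or_lt with ht | ht
  · have hs : s = 0 := by linarith
    simp [← ht, hs]
  · field_simp
    ring

theorem sq_div_le {s t : ℝ} (h0 : 0 ≤ s) (h1 : s ≤ t) : s ^ 2 / t ≤ t := by
  refine div_le_of_le_mul₀ (h0.trans h1) (h0.trans h1) ?_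
  nlinarith

/-- Splitting a cell into four raises its energy `s ^ 2 / t` by exactly the sum of the variances
`(sᵢ - c * tᵢ) ^ 2 / tᵢ` about the mean `c = s / t`. Only the first variance is kept. -/
theorem sq_sub_div_mul_div_le {s t s₁ s₂ s₃ s₄ t₁ t₂ t₃ t₄ : ℝ}
    (hs₁ : 0 ≤ s₁) (hs₂ : 0 ≤ s₂) (hs₃ : 0 ≤ s₃) (hs₄ : 0 ≤ s₄)
    (h₁ : s₁ ≤ t₁) (h₂ : s₂ ≤ t₂) (h₃ : s₃ ≤ t₃) (h₄ : s₄ ≤ t₄)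
    (hs : s = s₁ + s₂ + s₃ + s₄) (ht : t = t₁ + t₂ + t₃ + t₄) :
    (s₁ - s / t * t₁) ^ 2 / t₁ + s ^ 2 / t ≤
      s₁ ^ 2 / t₁ + s₂ ^ 2 / t₂ + s₃ ^ 2 / t₃ + s₄ ^ 2 / t₄ := by
  have e₁ := sq_sub_mul_div_eq hs₁ h₁ (s / t)
  have e₂ := sq_sub_mul_div_eq hs₂ h₂ (s / t)
  have e₃ := sq_sub_mul_div_eq hs₃ h₃ (s / t)
  have e₄ := sq_sub_mul_div_eq hs₄ h₄ (s / t)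
  have e := sq_sub_mul_div_eq (s := s) (t := t) (by linarith) (by linarith) (s / t)
  have n₂ : 0 ≤ (s₂ - s / t * t₂) ^ 2 / t₂ := div_nonneg (sq_nonneg _) (hs₂.trans h₂)
  have n₃ : 0 ≤ (s₃ - s / t * t₃) ^ 2 / t₃ := div_nonneg (sq_nonneg _) (hs₃.trans h₃)
  have n₄ : 0 ≤ (s₄ - s / t * t₄) ^ 2 / t₄ := div_nonneg (sq_nonneg _) (hs₄.trans h₄)
  have z : (s - s / t * t) ^ 2 / t = 0 := by
    rcases eq_or_ne t 0 with h | h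
    · simp [h]
    · simp [div_mul_cancel₀ _ h]
  have es : 2 * (s / t) * s =
      2 * (s / t) * s₁ + 2 * (s / t) * s₂ + 2 * (s / t) * s₃ + 2 * (s / t) * s₄ := by
    conv_lhs => enter [2]; rw [hs]
    ring
  have et : (s / t) ^ 2 * t =
      (s / t) ^ 2 * t₁ + (s / t) ^ 2 * t₂ + (s / t) ^ 2 * t₃ + (s / t) ^ 2 * t₄ := by
    conv_lhs => enter [2]; rw [ht]
    ring
  linarith

variable {B : Type*} [AddCommGroup B] [Module ℝ B] [Lattice B] [IsOrderedAddMonoid B]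

/-- The energy of a pair `S ≤ T` of positive operators with respect to finite families of vectors
and of functionals. -/
noncomputable def energy (S T : B →ₗ[ℝ] B) {ι κ : Type} [Fintype ι] [Fintype κ] (a : ι → B)
    (ψ : κ → B →ₗ[ℝ] ℝ) : ℝ :=
  ∑ i, ∑ j, ψ j (S (a i)) ^ 2 / ψ j (T (a i))

omit [Lattice B] [IsOrderedAddMonoid B] in
theorem sum_sum_apply_eq (T : B →ₗ[ℝ] B) {ι κ : Type} [Fintype ι] [Fintype κ] (a : ι → B)
    (ψ : κ → B →ₗ[ℝ] ℝ) : ∑ i, ∑ j, ψ j (T (a i)) = (∑ j, ψ j) (T (∑ i, a i)) := by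
  simp [LinearMap.sum_apply, map_sum]

variable {S T : B →ₗ[ℝ] B} (hST : ∀ f, 0 ≤ f → 0 ≤ S f ∧ S f ≤ T f)

include hST

theorem apply_nonneg_and_le {ψ : B →ₗ[ℝ] ℝ} (hψ : ∀ f, 0 ≤ f → 0 ≤ ψ f) {f : B} (hf : 0 ≤ f) :
    0 ≤ ψ (S f) ∧ ψ (S f) ≤ ψ (T f) := by
  refine ⟨hψ _ (hST f hf).1, ?_⟩
  have := hψ _ (sub_nonneg.2 (hST f hf).2)
  rw [map_sub] at this
  linarith

theorem energy_le {ι κ : Type} [Fintype ι] [Fintype κ] {a : ι → B} {ψ : κ → B →ₗ[ℝ] ℝ}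
    (ha : ∀ i, 0 ≤ a i) (hψ : ∀ j f, 0 ≤ f → 0 ≤ ψ j f) :
    energy S T a ψ ≤ (∑ j, ψ j) (T (∑ i, a i)) := by
  rw [← sum_sum_apply_eq]
  exact Finset.sum_le_sum fun i _ => Finset.sum_le_sum fun j _ =>
    sq_div_le (apply_nonneg_and_le hST (hψ j) (ha i)).1 (apply_nonneg_and_le hST (hψ j) (ha i)).2

/-- Refining both families increases the energy by at least the variance on the refined cells. -/
theorem sum_variance_add_energy_le {ι κ : Type} [Fintype ι] [Fintype κ] {a x : ι → B}
    {ψ θ : κ → B →ₗ[ℝ] ℝ} (hx : ∀ i, 0 ≤ x i ∧ x i ≤ a i)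
    (hθ : ∀ j f, 0 ≤ f → 0 ≤ θ j f ∧ θ j f ≤ ψ j f) :
    (∑ i, ∑ j, (θ j (S (x i)) - ψ j (S (a i)) / ψ j (T (a i)) * θ j (T (x i))) ^ 2
        / θ j (T (x i))) + energy S T a ψ ≤
      energy S T (fun p : ι × Bool => if p.2 then x p.1 else a p.1 - x p.1)
        (fun p : κ × Bool => if p.2 then θ p.1 else ψ p.1 - θ p.1) := by
  unfold energy
  simp only [Fintype.sum_prod_type, Fintype.sum_bool, if_true, Bool.false_eq_true, if_false]
  rw [← Finset.sum_add_distrib]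
  refine Finset.sum_le_sum fun i _ => ?_
  rw [← Finset.sum_add_distrib, ← Finset.sum_add_distrib]
  refine Finset.sum_le_sum fun j _ => ?_
  have h1 : ∀ f, 0 ≤ f → 0 ≤ θ j f := fun f hf => (hθ j f hf).1
  have h2 : ∀ f, 0 ≤ f → 0 ≤ (ψ j - θ j) f := fun f hf => by
    simpa using (hθ j f hf).2
  have hy : 0 ≤ a i - x i := sub_nonneg.2 (hx i).2
  have k1 := apply_nonneg_and_le hST h1 (hx i).1
  have k2 := apply_nonneg_and_le hST h2 (hx i).1
  have k3 := apply_nonneg_and_le hST h1 hy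
  have k4 := apply_nonneg_and_le hST h2 hy
  refine (sq_sub_div_mul_div_le k1.1 k2.1 k3.1 k4.1 k1.2 k2.2 k3.2 k4.2 ?_ ?_).trans_eq (by ring)
  · simp only [map_sub, LinearMap.sub_apply]; ring
  · simp only [map_sub, LinearMap.sub_apply]; ring

/-- A regularity lemma for `0 ≤ S ≤ T`: there are finite decompositions of `u` and of `φ` such that
on every refinement `S` is close to a multiple of `T`, with factors depending on the cell only. -/
theorem exists_regular_decomposition {φ : B →ₗ[ℝ] ℝ} (hφ : ∀ f, 0 ≤ f → 0 ≤ φ f) {u : B}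
    (hu : 0 ≤ u) {ε : ℝ} (hε : 0 < ε) :
    ∃ (ι κ : Type) (_ : Fintype ι) (_ : Fintype κ) (a : ι → B) (ψ : κ → B →ₗ[ℝ] ℝ)
      (c : ι → κ → ℝ), (∀ i, 0 ≤ a i) ∧ ∑ i, a i = u ∧ (∀ j f, 0 ≤ f → 0 ≤ ψ j f) ∧
        ∑ j, ψ j = φ ∧ (∀ i j, 0 ≤ c i j ∧ c i j ≤ 1) ∧
        ∀ (x : ι → B) (θ : κ → B →ₗ[ℝ] ℝ), (∀ i, 0 ≤ x i ∧ x i ≤ a i) →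
          (∀ j f, 0 ≤ f → 0 ≤ θ j f ∧ θ j f ≤ ψ j f) →
          |∑ i, ∑ j, (θ j (S (x i)) - c i j * θ j (T (x i)))| ≤ ε := by
  set M : ℝ := φ (T u)
  have hM : 0 ≤ M := hφ _ ((hST u hu).1.trans (hST u hu).2)
  let A : Set ℝ := {e | ∃ (ι κ : Type) (_ : Fintype ι) (_ : Fintype κ) (a : ι → B)
    (ψ : κ → B →ₗ[ℝ] ℝ), (∀ i, 0 ≤ a i) ∧ ∑ i, a i = u ∧ (∀ j f, 0 ≤ f → 0 ≤ ψ j f) ∧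
        ∑ j, ψ j = φ ∧ energy S T a ψ = e}
  have hne : A.Nonempty := ⟨_, Unit, Unit, inferInstance, inferInstance, fun _ => u, fun _ => φ,
    fun _ => hu, by simp, fun _ => hφ, by simp, rfl⟩
  have hbdd : BddAbove A := by
    refine ⟨M, ?_⟩
    rintro e ⟨ι, κ, _, _, a, ψ, ha, hau, hψ, hψφ, rfl⟩
    have := energy_le hST ha hψ
    rwa [hau, hψφ] at this
  -- Cauchy–Schwarz will bound the squared error by this number times `M`, hence by `ε ^ 2`; the `+
  -- 1` covers `M = 0`.
  have hδ : 0 < ε ^ 2 / (M + 1) := by positivity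
  obtain ⟨e, ⟨ι, κ, _, _, a, ψ, ha, hau, hψ, hψφ, rfl⟩, he⟩ :=
    exists_lt_of_lt_csSup hne (sub_lt_self (sSup A) hδ)
  refine ⟨ι, κ, inferInstance, inferInstance, a, ψ, fun i j => ψ j (S (a i)) / ψ j (T (a i)),
    ha, hau, hψ, hψφ, fun i j => ?_, fun x θ hx hθ => ?_⟩
  · obtain ⟨h1, h2⟩ := apply_nonneg_and_le hST (hψ j) (ha i)
    exact ⟨div_nonneg h1 (h1.trans h2), div_le_one_of_le₀ h2 (h1.trans h2)⟩
  · have hvar := sum_variance_add_energy_le hST hx hθ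
    -- The energy of the chosen decomposition is almost the supremum, so refining it by `x` and `θ`
    -- can gain little, and the variance on the refined cells is small.
    have hsup := le_csSup hbdd (show energy S T
        (fun p : ι × Bool => if p.2 then x p.1 else a p.1 - x p.1)
        (fun p : κ × Bool => if p.2 then θ p.1 else ψ p.1 - θ p.1) ∈ A from
      ⟨_, _, inferInstance, inferInstance, _, _, by
          rintro ⟨i, _ | _⟩
          · simpa using (hx i).2
          · simpa using (hx i).1, by
          rw [Fintype.sum_prod_type, ← hau]; simp, by
          rintro ⟨j, _ | _⟩ f hf
          · simpa using (hθ j f hf).2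
          · simpa using (hθ j f hf).1, by
          rw [Fintype.sum_prod_type, ← hψφ]; simp, rfl⟩)
    have hk : ∀ i j, 0 ≤ θ j (S (x i)) ∧ θ j (S (x i)) ≤ θ j (T (x i)) := fun i j =>
      apply_nonneg_and_le hST (fun f hf => (hθ j f hf).1) (hx i).1
    have hT0 : ∀ f, 0 ≤ f → 0 ≤ T f := fun f hf => (hST f hf).1.trans (hST f hf).2
    have htot : ∑ p : ι × κ, θ p.2 (T (x p.1)) ≤ M := by
      rw [Fintype.sum_prod_type]
      calc ∑ i, ∑ j, θ j (T (x i)) ≤ ∑ i, ∑ j, ψ j (T (a i)) := by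
            refine Finset.sum_le_sum fun i _ => Finset.sum_le_sum fun j _ => ?_
            refine (hθ j _ (hT0 _ (hx i).1)).2.trans ?_
            have := hψ j _ (hT0 _ (sub_nonneg.2 (hx i).2))
            rw [map_sub, map_sub] at this
            linarith
        _ = M := by rw [sum_sum_apply_eq, hau, hψφ]
    have hcs := Finset.sum_sq_le_sum_mul_sum_of_sq_le_mul (Finset.univ : Finset (ι × κ))
      (r := fun p => θ p.2 (S (x p.1)) - ψ p.2 (S (a p.1)) / ψ p.2 (T (a p.1))
        * θ p.2 (T (x p.1)))
      (f := fun p => (θ p.2 (S (x p.1)) - ψ p.2 (S (a p.1)) / ψ p.2 (T (a p.1))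
        * θ p.2 (T (x p.1))) ^ 2 / θ p.2 (T (x p.1)))
      (g := fun p => θ p.2 (T (x p.1)))
      (fun p _ => div_nonneg (sq_nonneg _) ((hk _ _).1.trans (hk _ _).2))
      (fun p _ => (hk _ _).1.trans (hk _ _).2)
      (fun p _ => by
        rcases eq_or_ne (θ p.2 (T (x p.1))) 0 with h | h
        · have := hk p.1 p.2
          rw [h] at this
          simp [h, le_antisymm this.2 this.1]
        · rw [div_mul_cancel₀ _ h])
    rw [Fintype.sum_prod_type, Fintype.sum_prod_type] at hcs
    refine abs_le_of_sq_le_sq (hcs.trans ?_) hε.le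
    refine (mul_le_mul (b := ε ^ 2 / (M + 1)) (by linarith) htot
      (Finset.sum_nonneg fun p _ => (hk _ _).1.trans (hk _ _).2) hδ.le).trans ?_
    rw [div_mul_eq_mul_div, div_le_iff₀ (by positivity)]
    exact mul_le_mul_of_nonneg_left (by linarith) (by positivity)

end Regularity

/-! ### Positive functionals and norm estimates. -/

section Functionals

universe u

variable {B : Type u} [NormedAddCommGroup B] [NormedSpace ℝ B] [Lattice B]
  [IsOrderedAddMonoid B] [IsOrderedModule ℝ B]

omit [IsOrderedAddMonoid B] in
theorem smul_posPart_eq {c : ℝ} (hc : 0 < c) (x : B) : (c • x)⁺ = c • x⁺ := by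
  have h := (OrderIso.smulRight (β := B) hc).map_sup x 0
  simp only [OrderIso.smulRight_apply, smul_zero] at h
  exact h.symm

omit [NormedSpace ℝ B] [IsOrderedModule ℝ B] in
theorem add_posPart_le (x y : B) : (x + y)⁺ ≤ x⁺ + y⁺ :=
  sup_le (add_le_add (le_posPart x) (le_posPart y))
    (add_nonneg (posPart_nonneg x) (posPart_nonneg y))

omit [IsOrderedModule ℝ B] in
theorem map_le_map_of_nonneg {φ : B →ₗ[ℝ] ℝ} (hφ : ∀ f, 0 ≤ f → 0 ≤ φ f) {x y : B} (h : x ≤ y) :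
    φ x ≤ φ y := by
  have := hφ _ (sub_nonneg.2 h)
  rw [map_sub] at this
  linarith

/-- Hahn–Banach for the sublinear functional `x ↦ φ x⁺`: evaluating the bound at `-f` and at `f`
gives the two inequalities. -/
theorem exists_functional_eq_posPart {φ : B →ₗ[ℝ] ℝ} (hφ : ∀ f, 0 ≤ f → 0 ≤ φ f) (y : B) :
    ∃ θ : B →ₗ[ℝ] ℝ, θ y = φ y⁺ ∧ ∀ f, 0 ≤ f → 0 ≤ θ f ∧ θ f ≤ φ f := by
  obtain ⟨θ, hy, hθ⟩ := exists_linearMap_eq_le_sublinear (fun x => φ x⁺)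
    (fun c hc x => by rw [smul_posPart_eq hc, map_smul, smul_eq_mul])
    (fun x y => by
      rw [← map_add]
      exact map_le_map_of_nonneg hφ (add_posPart_le x y)) y
  refine ⟨θ, hy, fun f hf => ⟨?_, ?_⟩⟩
  · have h := hθ (-f)
    rw [posPart_neg, negPart_eq_zero.2 hf, map_zero, map_neg] at h
    linarith
  · simpa [posPart_of_nonneg hf] using hθ f

variable [HasSolidNorm B]

omit [NormedSpace ℝ B] [IsOrderedModule ℝ B] in
theorem norm_le_norm_of_nonneg_of_le {x y : B} (hx : 0 ≤ x) (h : x ≤ y) : ‖x‖ ≤ ‖y‖ :=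
  norm_le_norm_of_abs_le_abs (by rwa [abs_of_nonneg hx, abs_of_nonneg (hx.trans h)])

omit [NormedSpace ℝ B] [IsOrderedAddMonoid B] [IsOrderedModule ℝ B] in
theorem norm_le_norm_of_abs_le {x y : B} (h : |x| ≤ y) : ‖x‖ ≤ ‖y‖ :=
  norm_le_norm_of_abs_le_abs (h.trans (le_abs_self y))

omit [NormedSpace ℝ B] [IsOrderedModule ℝ B] in
theorem norm_posPart_le_norm (x : B) : ‖x⁺‖ ≤ ‖x‖ := by
  rw [← norm_abs_eq_norm x]
  exact norm_le_norm_of_nonneg_of_le (posPart_nonneg x)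
    (sup_le (le_abs_self x) (abs_nonneg x))

/-- Using `‖x⁺‖` in place of `‖x‖` in Hahn–Banach forces positivity, since it vanishes at `-x` for
`x ≥ 0`. -/
theorem exists_positive_norming_functional {y : B} (hy : 0 ≤ y) :
    ∃ f : B →ₗ[ℝ] ℝ, f y = ‖y‖ ∧ (∀ x, 0 ≤ x → 0 ≤ f x) ∧ ∀ x, f x ≤ ‖x‖ := by
  obtain ⟨f, hfy, hf⟩ := exists_linearMap_eq_le_sublinear (fun x : B => ‖x⁺‖)
    (fun c hc x => by rw [smul_posPart_eq hc, norm_smul, Real.norm_of_nonneg hc.le])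
    (fun x y => (norm_le_norm_of_nonneg_of_le (posPart_nonneg _) (add_posPart_le x y)).trans
      (norm_add_le _ _)) y
  refine ⟨f, by simpa [posPart_of_nonneg hy] using hfy, fun x hx => ?_, fun x =>
    (hf x).trans (norm_posPart_le_norm x)⟩
  have h := hf (-x)
  simp only [posPart_neg, negPart_eq_zero.2 hx, norm_zero, map_neg] at h
  linarith

omit [IsOrderedModule ℝ B] [HasSolidNorm B] in
theorem abs_map_le_of_nonneg {T : B →L[ℝ] B} (hT : ∀ f, 0 ≤ f → 0 ≤ T f) (x : B) :
    |T x| ≤ T |x| := by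
  have h1 := hT _ (sub_nonneg.2 (le_abs_self x))
  have h2 := hT _ (sub_nonneg.2 (neg_le_abs x))
  rw [map_sub, sub_nonneg] at h1 h2
  rw [map_neg] at h2
  exact abs_le'.2 ⟨h1, h2⟩

omit [IsOrderedModule ℝ B] in
theorem norm_map_le_of_dominated {S T : B →L[ℝ] B} (hST : ∀ f, 0 ≤ f → 0 ≤ S f ∧ S f ≤ T f)
    (x : B) : ‖S x‖ ≤ ‖T |x|‖ :=
  norm_le_norm_of_abs_le ((abs_map_le_of_nonneg (fun f hf => (hST f hf).1) x).trans
    (hST _ (abs_nonneg x)).2)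

end Functionals

/-! ### Total boundedness by finite colorings; the three-operator theorem. -/

section Colorings

universe u

theorem exists_coloring_of_totallyBounded {X : Type u} [PseudoMetricSpace X] {s : Set X}
    (hs : TotallyBounded s) {ε : ℝ} (hε : 0 < ε) :
    ∃ (γ : Type u) (_ : Fintype γ) (c : X → γ), ∀ x ∈ s, ∀ y ∈ s, c x = c y → dist x y < ε := by
  obtain ⟨t, ht, hst⟩ := Metric.totallyBounded_iff.1 hs (ε / 2) (half_pos hε)
  have hfin : Fintype t := ht.fintype
  have h : ∀ x : X, ∃ z : Option t, x ∈ s → ∃ w : t, z = some w ∧ dist x w < ε / 2 := by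
    intro x
    by_cases hx : x ∈ s
    · obtain ⟨w, hw, hxw⟩ := Set.mem_iUnion₂.1 (hst hx)
      exact ⟨some ⟨w, hw⟩, fun _ => ⟨⟨w, hw⟩, rfl, hxw⟩⟩
    · exact ⟨none, fun h => absurd h hx⟩
  choose c hc using h
  refine ⟨Option t, inferInstance, c, fun x hx y hy hxy => ?_⟩
  obtain ⟨w, hw, hxw⟩ := hc x hx
  obtain ⟨w', hw', hyw⟩ := hc y hy
  obtain rfl : w = w' := by simpa [hw, hw'] using hxy
  calc dist x y ≤ dist x w + dist y w := dist_triangle_right _ _ _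
    _ < ε := by linarith

variable {B : Type u} [NormedAddCommGroup B] [NormedSpace ℝ B] [Lattice B]
  [IsOrderedAddMonoid B] [IsOrderedModule ℝ B] [HasSolidNorm B]

omit [Lattice B] [IsOrderedAddMonoid B] [IsOrderedModule ℝ B] [HasSolidNorm B] in
theorem totallyBounded_image_closedBall {T : B →L[ℝ] B} (hT : IsCompactOperator T) (r : ℝ) :
    TotallyBounded (T '' Metric.closedBall 0 r) := by
  obtain ⟨K, hK, hs⟩ := IsCompactOperator.image_closedBall_subset_compact
    (f := (T : B →ₗ[ℝ] B)) hT r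
  exact hK.totallyBounded.subset hs

/-- If `0 ≤ S ≤ T` with `T` compact, then `S` maps order intervals to sets that are totally bounded
for the seminorm `φ |·|` defined by a positive functional `φ`. -/
theorem exists_coloring_of_dominated {S T : B →L[ℝ] B}
    (hST : ∀ f, 0 ≤ f → 0 ≤ S f ∧ S f ≤ T f) (hT : IsCompactOperator T) {φ : B →ₗ[ℝ] ℝ}
    (hφ : ∀ f, 0 ≤ f → 0 ≤ φ f) {C : ℝ} (hC0 : 0 ≤ C) (hC : ∀ f, φ f ≤ C * ‖f‖) {u : B}
    (hu : 0 ≤ u) {ε : ℝ} (hε : 0 < ε) :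
    ∃ (γ : Type u) (_ : Fintype γ) (c : B → γ), ∀ w w', 0 ≤ w → w ≤ u → 0 ≤ w' → w' ≤ u →
      c w = c w' → φ |S (w - w')| ≤ ε := by
  obtain ⟨ι, κ, _, _, a, ψ, c, ha, hau, hψ, hψφ, hc, hreg⟩ :=
    exists_regular_decomposition (S := (S : B →ₗ[ℝ] B)) (T := (T : B →ₗ[ℝ] B)) hST hφ hu
      (ε := ε / 8) (by positivity)
  -- Chosen so that `card ι` errors of size `C * δ` add up to at most `ε / 4`.
  have hδ : 0 < ε / (4 * (Fintype.card ι * C + 1)) := by positivity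
  obtain ⟨γ, _, c₀, hc₀⟩ :=
    exists_coloring_of_totallyBounded (totallyBounded_image_closedBall hT ‖u‖) hδ
  have hdec : ∀ w, ∃ x : ι → B, 0 ≤ w → w ≤ u → (∀ i, 0 ≤ x i ∧ x i ≤ a i) ∧ ∑ i, x i = w := by
    intro w
    by_cases h : 0 ≤ w ∧ w ≤ u
    · obtain ⟨x, hx⟩ := exists_sum_eq_of_le_sum Finset.univ ha h.1 (h.2.trans_eq hau.symm)
      exact ⟨x, fun _ _ => hx⟩
    · exact ⟨0, fun h1 h2 => absurd ⟨h1, h2⟩ h⟩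
  choose x hx using hdec
  classical
  have key : ∀ w w', 0 ≤ w → w ≤ u → 0 ≤ w' → w' ≤ u →
      (∀ i, c₀ (T (x w i)) = c₀ (T (x w' i))) → φ (S (w - w'))⁺ ≤ ε / 2 := by
    intro w w' hw hwu hw' hwu' hcol
    obtain ⟨hxa, hxw⟩ := hx w hw hwu
    obtain ⟨hxa', hxw'⟩ := hx w' hw' hwu'
    -- The `θ j` depend on `w - w'`, yet the regularity bound is uniform in `θ`, so it applies to
    -- `w` and `w'` with the same `θ`. The two errors `ε / 8` and the `T`-part `ε / 4` make `ε / 2`.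
    choose θ hθ hθψ using fun j => exists_functional_eq_posPart (hψ j) (S (w - w'))
    have hθsum : ∀ v : ι → B, ∑ j, θ j (S (∑ i, v i)) = ∑ i, ∑ j, θ j (S (v i)) := by
      intro v
      rw [Finset.sum_comm]
      simp [map_sum]
    have e : φ (S (w - w'))⁺ = ∑ i, ∑ j, θ j (S (x w i)) - ∑ i, ∑ j, θ j (S (x w' i)) := by
      rw [← hθsum, ← hθsum, hxw, hxw', ← Finset.sum_sub_distrib, ← hψφ, LinearMap.sum_apply]
      refine Finset.sum_congr rfl fun j _ => ?_
      rw [← hθ, map_sub, map_sub]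
    have r1 := (abs_le.1 (hreg (x w) θ hxa hθψ)).2
    have r2 := (abs_le.1 (hreg (x w') θ hxa' hθψ)).1
    simp only [Finset.sum_sub_distrib, ContinuousLinearMap.coe_coe] at r1 r2
    have hT : ∑ i, ∑ j, c i j * θ j (T (x w i)) - ∑ i, ∑ j, c i j * θ j (T (x w' i)) ≤ ε / 4 := by
      calc ∑ i, ∑ j, c i j * θ j (T (x w i)) - ∑ i, ∑ j, c i j * θ j (T (x w' i))
          = ∑ i, ∑ j, c i j * θ j (T (x w i) - T (x w' i)) := by
            simp only [← Finset.sum_sub_distrib, map_sub, mul_sub]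
        _ ≤ ∑ i, ∑ j, ψ j |T (x w i) - T (x w' i)| := by
            refine Finset.sum_le_sum fun i _ => Finset.sum_le_sum fun j _ => ?_
            have h1 := map_le_map_of_nonneg (fun f hf => (hθψ j f hf).1)
              (le_abs_self (T (x w i) - T (x w' i)))
            have h2 := hθψ j _ (abs_nonneg (T (x w i) - T (x w' i)))
            calc _ ≤ c i j * θ j |T (x w i) - T (x w' i)| :=
                  mul_le_mul_of_nonneg_left h1 (hc i j).1
              _ ≤ θ j |T (x w i) - T (x w' i)| := mul_le_of_le_one_left h2.1 (hc i j).2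
              _ ≤ _ := h2.2
        _ = ∑ i, φ |T (x w i) - T (x w' i)| := by
            simp only [← hψφ, LinearMap.sum_apply]
        _ ≤ ∑ _i : ι, C * (ε / (4 * (Fintype.card ι * C + 1))) := by
            refine Finset.sum_le_sum fun i _ => (hC _).trans (mul_le_mul_of_nonneg_left ?_ hC0)
            rw [norm_abs_eq_norm, ← dist_eq_norm]
            have hmem : ∀ v, (∀ i, 0 ≤ x v i ∧ x v i ≤ a i) →
                T (x v i) ∈ T '' Metric.closedBall 0 ‖u‖ := by
              refine fun v hv => ⟨_, ?_, rfl⟩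
              rw [mem_closedBall_zero_iff]
              refine norm_le_norm_of_nonneg_of_le (hv i).1 ((hv i).2.trans ?_)
              rw [← hau]
              exact Finset.single_le_sum (fun i _ => ha i) (Finset.mem_univ i)
            exact (hc₀ _ (hmem w hxa) _ (hmem w' hxa') (hcol i)).le
        _ ≤ ε / 4 := by
            rw [Finset.sum_const, Finset.card_univ, nsmul_eq_mul]
            have : 0 < (Fintype.card ι * C + 1) := by positivity
            rw [← mul_assoc, mul_div_assoc', div_le_div_iff₀ (by positivity) (by positivity)]
            nlinarith
    linarith
  -- The color of `w` records, for every piece of its decomposition, the color of the image under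
  -- `T`.
  refine ⟨ι → γ, inferInstance, fun w i => c₀ (T (x w i)), fun w w' hw hwu hw' hwu' hcol => ?_⟩
  have hcol' : ∀ i, c₀ (T (x w i)) = c₀ (T (x w' i)) := fun i => congrFun hcol i
  have k1 := key w w' hw hwu hw' hwu' hcol'
  have k2 := key w' w hw' hwu' hw hwu fun i => (hcol' i).symm
  rw [← neg_sub, map_neg, posPart_neg] at k2
  rw [← posPart_add_negPart, map_add]
  linarith

omit [IsOrderedModule ℝ B] in
/-- An operator dominated by a compact operator maps the unit ball into an order interval, up to
an arbitrarily small error. -/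
theorem exists_order_interval_of_dominated {S T : B →L[ℝ] B}
    (hST : ∀ f, 0 ≤ f → 0 ≤ S f ∧ S f ≤ T f) (hT : IsCompactOperator T) {ε : ℝ} (hε : 0 < ε) :
    ∃ u v : B, 0 ≤ u ∧ ∀ x, ‖x‖ ≤ 1 → ∃ w, 0 ≤ w ∧ w ≤ u ∧ ‖S x - (w - v)‖ ≤ ε := by
  obtain ⟨t, ht, hst⟩ := Metric.totallyBounded_iff.1 (totallyBounded_image_closedBall hT 1) ε hε
  lift t to Finset B using ht
  have hv : 0 ≤ ∑ y ∈ t, |y| := Finset.sum_nonneg fun y _ => abs_nonneg y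
  refine ⟨∑ y ∈ t, |y| + ∑ y ∈ t, |y|, ∑ y ∈ t, |y|, add_nonneg hv hv, fun x hx => ?_⟩
  obtain ⟨y, hy, hxy⟩ := Set.mem_iUnion₂.1 (hst ⟨|x|, by simpa [norm_abs_eq_norm] using hx, rfl⟩)
  rw [mem_ball_iff_norm] at hxy
  set v := ∑ y ∈ t, |y|
  set e := |T |x| - y|
  have hyv : |y| ≤ v := Finset.single_le_sum (f := fun y => |y|) (fun y _ => abs_nonneg y) hy
  have hz : |S x| ≤ v + e := by
    calc |S x| ≤ S |x| := abs_map_le_of_nonneg (fun f hf => (hST f hf).1) x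
      _ ≤ T |x| := (hST _ (abs_nonneg x)).2
      _ = y + (T |x| - y) := by abel
      _ ≤ v + e := add_le_add ((le_abs_self y).trans hyv) (le_abs_self _)
  obtain ⟨hz1, hz2⟩ := abs_le'.1 hz
  have he : 0 ≤ e := abs_nonneg _
  have h0 : 0 ≤ S x + (v + e) := neg_le_iff_add_nonneg'.1 hz2
  -- `S x + v` lies in `[-e, 2v + e]`; shifting by `e` and truncating at `2v` gives a point of `[0,
  -- 2v]` that differs from `S x + v` by at most `e`.
  refine ⟨(S x + (v + e)) ⊓ (v + v), le_inf h0 (add_nonneg hv hv), inf_le_right, ?_⟩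
  refine (norm_le_norm_of_abs_le (y := e) (abs_le'.2 ⟨?_, ?_⟩)).trans ?_
  · have : S x + v - e ≤ (S x + (v + e)) ⊓ (v + v) := by
      refine le_inf ?_ ?_
      · rw [← add_assoc]
        exact (sub_le_self _ he).trans (le_add_of_nonneg_right he)
      · rw [sub_le_iff_le_add]
        calc S x + v ≤ v + e + v := by gcongr
          _ = v + v + e := by abel
    rw [sub_le_iff_le_add] at this ⊢
    calc S x = S x + v - v := by abel
      _ ≤ (S x + (v + e)) ⊓ (v + v) + e - v := by gcongr
      _ = _ := by abel
  · rw [neg_sub, sub_sub, sub_le_iff_le_add]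
    exact inf_le_left.trans_eq (by abel)
  · exact (norm_abs_eq_norm _).trans_le hxy.le

/-- An operator dominated by a compact operator is bounded by a positive functional, up to an
arbitrarily small error. -/
theorem exists_functional_of_dominated {S T : B →L[ℝ] B}
    (hST : ∀ f, 0 ≤ f → 0 ≤ S f ∧ S f ≤ T f) (hT : IsCompactOperator T) {ε : ℝ} (hε : 0 < ε) :
    ∃ (φ : B →ₗ[ℝ] ℝ) (C : ℝ), (∀ f, 0 ≤ f → 0 ≤ φ f) ∧ 0 ≤ C ∧ (∀ f, φ f ≤ C * ‖f‖) ∧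
      ∀ x, ‖S x‖ ≤ φ |x| + ε * ‖x‖ := by
  have hT0 : ∀ f, 0 ≤ f → 0 ≤ T f := fun f hf => (hST f hf).1.trans (hST f hf).2
  -- The net is taken inside the image of the positive part of the ball, so its points are positive
  -- and have positive norming functionals. Summing these composed with `T` gives `φ`.
  obtain ⟨t, htK, ht, hst⟩ := Metric.finite_approx_of_totallyBounded
    ((totallyBounded_image_closedBall hT 1).subset
      (Set.image_mono (Set.inter_subset_left (t := {x | 0 ≤ x})))) (ε / 2) (half_pos hε)
  lift t to Finset B using ht
  have hf : ∀ y : t, ∃ f : B →ₗ[ℝ] ℝ, f y = ‖(y : B)‖ ∧ (∀ x, 0 ≤ x → 0 ≤ f x) ∧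
      ∀ x, f x ≤ ‖x‖ := by
    rintro ⟨y, hy⟩
    obtain ⟨x, hx, rfl⟩ := htK hy
    exact exists_positive_norming_functional (hT0 _ hx.2)
  choose f hfy hf0 hf1 using hf
  have hφ : ∀ x, 0 ≤ x → 0 ≤ (∑ y, f y ∘ₗ (T : B →ₗ[ℝ] B)) x := fun x hx => by
    rw [LinearMap.sum_apply]
    exact Finset.sum_nonneg fun y _ => hf0 y _ (hT0 x hx)
  refine ⟨∑ y, f y ∘ₗ (T : B →ₗ[ℝ] B), Fintype.card t * ‖T‖, hφ, by positivity, fun x => ?_, ?_⟩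
  · rw [LinearMap.sum_apply, mul_assoc, ← nsmul_eq_mul, ← Finset.card_univ, ← Finset.sum_const]
    exact Finset.sum_le_sum fun y _ => (hf1 y _).trans (T.le_opNorm x)
  · have key : ∀ x, 0 ≤ x → ‖x‖ ≤ 1 →
        ‖T x‖ ≤ (∑ y, f y ∘ₗ (T : B →ₗ[ℝ] B)) x + ε := by
      intro x hx0 hx
      obtain ⟨y, hy, hxy⟩ := Set.mem_iUnion₂.1 (hst ⟨x, ⟨by simpa using hx, hx0⟩, rfl⟩)
      rw [mem_ball_iff_norm] at hxy
      have h1 : f ⟨y, hy⟩ (T x) ≤ (∑ y, f y ∘ₗ (T : B →ₗ[ℝ] B)) x := by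
        rw [LinearMap.sum_apply]
        exact Finset.single_le_sum (f := fun y => (f y ∘ₗ (T : B →ₗ[ℝ] B)) x)
          (fun y _ => hf0 y _ (hT0 x hx0)) (Finset.mem_univ _)
      have h2 := hf1 ⟨y, hy⟩ (y - T x)
      rw [map_sub, hfy, norm_sub_rev] at h2
      have h3 := norm_le_norm_add_norm_sub' (T x) y
      linarith
    intro x
    refine (norm_map_le_of_dominated hST x).trans ?_
    rcases eq_or_ne x 0 with rfl | hx
    · simp
    · have hx0 : 0 < ‖x‖ := norm_pos_iff.2 hx
      have h := key (‖x‖⁻¹ • |x|) (smul_nonneg (inv_nonneg.2 hx0.le) (abs_nonneg x))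
        (by rw [norm_smul, norm_abs_eq_norm, norm_inv, norm_norm, inv_mul_cancel₀ hx0.ne'])
      rw [map_smul, map_smul, norm_smul, norm_inv, norm_norm, smul_eq_mul] at h
      have h' := mul_le_mul_of_nonneg_left h hx0.le
      rwa [mul_add, mul_inv_cancel_left₀ hx0.ne', mul_inv_cancel_left₀ hx0.ne', mul_comm ‖x‖ ε]
        at h'

/-- The product of three operators dominated by compact operators is compact. -/
theorem isCompactOperator_mul_mul_of_dominated [CompleteSpace B] {S₁ S₂ S₃ T₁ T₂ T₃ : B →L[ℝ] B}
    (h₁ : ∀ f, 0 ≤ f → 0 ≤ S₁ f ∧ S₁ f ≤ T₁ f) (h₂ : ∀ f, 0 ≤ f → 0 ≤ S₂ f ∧ S₂ f ≤ T₂ f)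
    (h₃ : ∀ f, 0 ≤ f → 0 ≤ S₃ f ∧ S₃ f ≤ T₃ f) (hT₁ : IsCompactOperator T₁)
    (hT₂ : IsCompactOperator T₂) (hT₃ : IsCompactOperator T₃) :
    IsCompactOperator (S₃ * S₂ * S₁) := by
  suffices hs : TotallyBounded ((S₃ * S₂ * S₁) '' Metric.closedBall 0 1) by
    refine (isCompactOperator_iff_isCompact_closure_image_closedBall
      ((S₃ * S₂ * S₁ : B →L[ℝ] B) : B →ₗ[ℝ] B) one_pos).2 ?_
    exact hs.closure.isCompact_of_isClosed isClosed_closure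
  refine Metric.totallyBounded_of_finite_discretization fun ε hε => ?_
  -- The constants make the final distance at most `3ε / 4`: `ε / 4` from the two interval errors,
  -- `ε / 4` from the coloring, `ε / 4` from the norm term in the bound for `S₃`.
  obtain ⟨u, v, hu, huv⟩ := exists_order_interval_of_dominated h₁ hT₁
    (ε := ε / (8 * (‖S₃ * S₂‖ + 1))) (by positivity)
  obtain ⟨φ, C, hφ, hC0, hC, hφS⟩ := exists_functional_of_dominated h₃ hT₃
    (ε := ε / (4 * (‖S₂‖ * ‖u‖ + 1))) (by positivity)
  obtain ⟨γ, _, c, hc⟩ := exists_coloring_of_dominated h₂ hT₂ hφ hC0 hC hu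
    (ε := ε / 4) (by positivity)
  have hpre : ∀ z : (S₃ * S₂ * S₁) '' Metric.closedBall 0 1,
      ∃ w e, 0 ≤ w ∧ w ≤ u ∧ ‖e‖ ≤ ε / (8 * (‖S₃ * S₂‖ + 1)) ∧
        (z : B) = (S₃ * S₂) (w - v + e) := by
    rintro ⟨_, x, hx, rfl⟩
    obtain ⟨w, hw0, hwu, hw⟩ := huv x (by simpa using hx)
    exact ⟨w, S₁ x - (w - v), hw0, hwu, hw, by
      rw [add_sub_cancel]; rfl⟩
  choose w e hw0 hwu he hz using hpre
  refine ⟨γ, inferInstance, fun z => c (w z), fun z z' hcol => ?_⟩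
  have hd : (z : B) - z' = S₃ (S₂ (w z - w z')) + (S₃ * S₂) (e z - e z') := by
    rw [hz z, hz z', ← map_sub, ← mul_apply_eq_comp, ← map_add]
    congr 1
    abel
  rw [dist_eq_norm, hd]
  have b1 : ‖S₃ (S₂ (w z - w z'))‖ ≤ ε / 2 := by
    refine (hφS _).trans ?_
    have k1 := hc (w z) (w z') (hw0 z) (hwu z) (hw0 z') (hwu z') hcol
    have k2 : ‖S₂ (w z - w z')‖ ≤ ‖S₂‖ * ‖u‖ := by
      refine S₂.le_opNorm_of_le (norm_le_norm_of_abs_le (abs_le'.2 ⟨?_, ?_⟩))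
      · exact (sub_le_self _ (hw0 z')).trans (hwu z)
      · rw [neg_sub]
        exact (sub_le_self _ (hw0 z)).trans (hwu z')
    have k3 : ε / (4 * (‖S₂‖ * ‖u‖ + 1)) * ‖S₂ (w z - w z')‖ ≤ ε / 4 := by
      rw [div_mul_eq_mul_div, div_le_div_iff₀ (by positivity) (by positivity)]
      nlinarith
    linarith
  have b2 : ‖(S₃ * S₂) (e z - e z')‖ ≤ ε / 4 := by
    refine ((S₃ * S₂).le_opNorm_of_le ((norm_sub_le _ _).trans (add_le_add (he z) (he z')))).trans
      ?_
    have : 0 ≤ ‖S₃ * S₂‖ := norm_nonneg _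
    rw [← add_div, mul_div_assoc', div_le_div_iff₀ (by positivity) (by positivity)]
    nlinarith
  exact (norm_add_le _ _).trans_lt (by linarith)

end Colorings

/-! ### From the spectral radius to growth of powers. -/

section SpectralRadius

variable {B : Type*} [NormedAddCommGroup B] [NormedSpace ℝ B]

/-- Precomposition with a bounded operator, as a complex-linear operator on the space of
complex-valued bounded functionals. -/
noncomputable def precompDual (Q : B →L[ℝ] B) : (B →L[ℝ] ℂ) →L[ℂ] (B →L[ℝ] ℂ) :=
  LinearMap.mkContinuous
    { toFun := fun f => f.comp Q
      map_add' := fun _ _ => rfl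
      map_smul' := fun _ _ => rfl } ‖Q‖
    fun f => (f.opNorm_comp_le Q).trans_eq (mul_comm _ _)

@[simp]
theorem precompDual_apply (Q : B →L[ℝ] B) (f : B →L[ℝ] ℂ) : precompDual Q f = f.comp Q := rfl

/-- Test on a real functional norming `Q x`, regarded as complex-valued. -/
theorem norm_le_norm_precompDual (Q : B →L[ℝ] B) : ‖Q‖ ≤ ‖precompDual Q‖ := by
  refine Q.opNorm_le_bound (norm_nonneg (precompDual Q)) fun x => ?_
  rcases eq_or_ne (Q x) 0 with h | h
  · rw [h, norm_zero]
    positivity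
  obtain ⟨g, hg, hgx⟩ := exists_dual_vector ℝ (Q x) (norm_ne_zero_iff.2 h)
  have hf : ‖Complex.ofRealCLM.comp g‖ ≤ 1 := by
    refine ContinuousLinearMap.opNorm_le_bound _ zero_le_one fun y => ?_
    simpa [hg] using g.le_opNorm y
  have h1 := ((precompDual Q) (Complex.ofRealCLM.comp g)).le_opNorm x
  have h2 := (precompDual Q).le_opNorm_of_le hf
  have h3 : ‖(precompDual Q) (Complex.ofRealCLM.comp g) x‖ = ‖Q x‖ := by
    simp [hgx]
  rw [h3] at h1
  rw [mul_one] at h2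
  exact h1.trans (mul_le_mul_of_nonneg_right h2 (norm_nonneg x))

/-- `precompDual` as an algebra homomorphism. -/
noncomputable def precompDualHom :
    (B →L[ℝ] B) →ₐ[ℝ] ((B →L[ℝ] ℂ) →L[ℂ] (B →L[ℝ] ℂ))ᵐᵒᵖ where
  toFun Q := MulOpposite.op (precompDual Q)
  map_one' := rfl
  map_mul' _ _ := rfl
  map_zero' := by
    refine congrArg MulOpposite.op ?_
    ext f x
    simp
  map_add' Q R := by
    refine congrArg MulOpposite.op ?_
    ext f x
    simp
  commutes' c := by
    refine congrArg MulOpposite.op ?_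
    ext f x
    simp [Algebra.algebraMap_eq_smul_one]

/-- The extension of `precompDualHom` to the complexification. -/
noncomputable def complexPrecompDualHom :
    (ℂ ⊗[ℝ] (B →L[ℝ] B)) →ₐ[ℂ] ((B →L[ℝ] ℂ) →L[ℂ] (B →L[ℝ] ℂ))ᵐᵒᵖ :=
  Algebra.TensorProduct.lift (Algebra.ofId ℂ _) precompDualHom
    fun c Q => show Commute (algebraMap ℂ _ c) (precompDualHom Q) from Algebra.commutes c _

theorem complexPrecompDualHom_tmul (Q : B →L[ℝ] B) :
    complexPrecompDualHom ((1 : ℂ) ⊗ₜ[ℝ] Q) = MulOpposite.op (precompDual Q) := by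
  refine (Algebra.TensorProduct.lift_tmul _ _ _ _ _).trans ?_
  refine MulOpposite.unop_injective ?_
  ext f x
  exact one_smul ℂ (f (Q x))

/-- Powers of `Q` grow at most like powers of any number exceeding the spectral radius. -/
theorem exists_norm_pow_le_of_specRadius_lt (Q : B →L[ℝ] B) {r : NNReal}
    (hr : specRadius Q < r) : ∃ M : ℝ, 0 ≤ M ∧ ∀ n : ℕ, ‖Q ^ n‖ ≤ M * (r : ℝ) ^ n := by
  have hr0 : 0 < r := ENNReal.coe_pos.1 (bot_le.trans_lt hr)
  set D : ((B →L[ℝ] ℂ) →L[ℂ] (B →L[ℝ] ℂ))ᵐᵒᵖ := MulOpposite.op (precompDual Q)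
  -- Algebra homomorphisms shrink spectra, so Gelfand's formula can be applied in the Banach algebra
  -- containing `D`; the opposite algebra appears because precomposition reverses products.
  have hD : spectralRadius ℂ D ≤ specRadius Q := by
    have hs : spectrum ℂ D ⊆ spectrum ℂ ((1 : ℂ) ⊗ₜ[ℝ] Q) := by
      have := AlgHom.spectrum_apply_subset complexPrecompDualHom ((1 : ℂ) ⊗ₜ[ℝ] Q)
      rwa [complexPrecompDualHom_tmul] at this
    exact biSup_mono fun k hk => hs hk
  have hnorm : ∀ n, ‖Q ^ n‖ ≤ ‖D ^ n‖ := by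
    intro n
    have : D ^ n = MulOpposite.op (precompDual (Q ^ n)) := by
      induction n with
      | zero => rfl
      | succ n ih => rw [pow_succ, ih, pow_succ]; rfl
    rw [this]
    exact norm_le_norm_precompDual _
  have hev := (spectrum.pow_nnnorm_pow_one_div_tendsto_nhds_spectralRadius D).eventually_lt_const
    (hD.trans_lt hr)
  obtain ⟨N, hN⟩ := (hev.and (eventually_ne_atTop 0)).exists_forall_of_atTop
  have hbig : ∀ n, N ≤ n → ‖Q ^ n‖ ≤ (r : ℝ) ^ n := by
    intro n hn
    obtain ⟨h1, h2⟩ := hN n hn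
    refine (hnorm n).trans ?_
    have hn' : (0 : ℝ) < n := by exact_mod_cast Nat.pos_of_ne_zero h2
    have h3 := (ENNReal.rpow_le_rpow_iff hn').2 h1.le
    rw [← ENNReal.rpow_mul, one_div_mul_cancel hn'.ne', ENNReal.rpow_one,
      ENNReal.rpow_natCast] at h3
    exact_mod_cast h3
  -- The sum takes care of the finitely many exponents below `N`.
  refine ⟨1 + ∑ n ∈ Finset.range N, ‖Q ^ n‖ / (r : ℝ) ^ n, by positivity, fun n => ?_⟩
  have hrn : 0 < (r : ℝ) ^ n := by positivity
  rcases le_or_gt N n with hn | hn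
  · refine (hbig n hn).trans (le_mul_of_one_le_left hrn.le (le_add_of_nonneg_right ?_))
    positivity
  · rw [← div_le_iff₀ hrn]
    refine (Finset.single_le_sum (f := fun n => ‖Q ^ n‖ / (r : ℝ) ^ n)
      (fun n _ => by positivity) (Finset.mem_range.2 hn)).trans (by linarith)

/-- If `Q ^ n` is at distance at most `M * r ^ n` from the compact operators for all `n`, then the
essential spectral radius of `Q` is at most `r`. -/
theorem essentialSpectralRadius_le {Q : B →L[ℝ] B} {r : NNReal} {M : ℝ}
    (h : ∀ n : ℕ, ∃ K : B →L[ℝ] B, IsCompactOperator K ∧ ‖Q ^ n - K‖ ≤ M * (r : ℝ) ^ n) :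
    essentialSpectralRadius Q ≤ r := by
  have hM : 0 ≤ M := by
    obtain ⟨K, -, hK⟩ := h 0
    simpa using (norm_nonneg _).trans hK
  have hlim : Tendsto (fun n : ℕ => ENNReal.ofReal ((M + 1) ^ (1 / (n : ℝ))) * r) atTop
      (𝓝 (ENNReal.ofReal 1 * r)) := by
    refine ENNReal.Tendsto.mul_const ?_ (Or.inl (by simp))
    refine (ENNReal.continuous_ofReal.tendsto _).comp ?_
    -- `M + 1` rather than `M`, since continuity of `x ↦ a ^ x` at `0` needs `a ≠ 0`.
    have h0 := (Real.continuousAt_const_rpow (a := M + 1) (b := 0) (by positivity)).tendsto.comp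
      tendsto_one_div_atTop_nhds_zero_nat
    simpa [Function.comp_def] using h0
  rw [ENNReal.ofReal_one, one_mul] at hlim
  refine le_of_tendsto_of_tendsto (tendsto_essentialSpectralRadius Q) hlim ?_
  filter_upwards [eventually_ne_atTop 0] with n hn
  obtain ⟨K, hK, hKn⟩ := h n
  refine (iInf_le _ (⟨K, hK⟩ : {K : B →L[ℝ] B // IsCompactOperator K})).trans ?_
  have hn' : (0 : ℝ) < n := by exact_mod_cast Nat.pos_of_ne_zero hn
  have h1 : ‖Q ^ n - K‖ₑ ≤ ENNReal.ofReal (M + 1) * (r : ℝ≥0∞) ^ n := by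
    rw [← ofReal_norm, ← ENNReal.ofReal_coe_nnreal, ← ENNReal.ofReal_pow r.coe_nonneg,
      ← ENNReal.ofReal_mul (by positivity)]
    refine ENNReal.ofReal_le_ofReal (hKn.trans ?_)
    exact mul_le_mul_of_nonneg_right (by linarith) (by positivity)
  refine (ENNReal.rpow_le_rpow h1 (by positivity)).trans_eq ?_
  rw [ENNReal.mul_rpow_of_nonneg _ _ (by positivity), ← ENNReal.rpow_natCast, ← ENNReal.rpow_mul,
    mul_one_div_cancel hn'.ne', ENNReal.rpow_one, ENNReal.ofReal_rpow_of_nonneg (by positivity)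
    (by positivity)]

end SpectralRadius

/-! ### Norms of words with few factors `R`. -/

section Words

/-- The sum of all words of length `n` in `R` and `S` with exactly `k` factors `R`. -/
def wordSum {A : Type*} [Ring A] (R S : A) : ℕ → ℕ → A
  | 0, n => S ^ n
  | _ + 1, 0 => 0
  | k + 1, n + 1 => wordSum R S (k + 1) n * S + wordSum R S k n * R

theorem exists_mul_pow_le {r r' : ℝ} (hr' : 0 ≤ r') (h : r' < r) :
    ∃ L : ℝ, 0 ≤ L ∧ ∀ n m : ℕ, n * r' ^ (n + m) ≤ L * r ^ (n + m) := by
  have hr : 0 < r := hr'.trans_lt h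
  obtain ⟨L, hL⟩ := (tendsto_self_mul_const_pow_of_lt_one (div_nonneg hr' hr.le)
    ((div_lt_one hr).2 h)).bddAbove_range
  have hL' : ∀ n : ℕ, n * (r' / r) ^ n ≤ L := fun n => hL ⟨n, rfl⟩
  refine ⟨L, by simpa using hL' 0, fun n m => ?_⟩
  calc n * r' ^ (n + m) = (n * (r' / r) ^ n) * (r ^ n * r' ^ m) := by
        rw [div_pow, pow_add]
        field_simp
    _ ≤ L * (r ^ n * r ^ m) := by
        have hm : r' ^ m ≤ r ^ m := pow_le_pow_left₀ hr' h.le m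
        have := hL' n
        have : 0 ≤ L := by simpa using hL' 0
        gcongr
    _ = L * r ^ (n + m) := by rw [pow_add]

/-- The tail `S ^ m` makes the induction on `n` close: a last letter `S` joins the tail, a last
letter `R` leaves a sum with one `R` fewer. Each `R` costs a factor of order `n`, absorbed by
passing from `r'` to a larger `r`. -/
theorem exists_norm_wordSum_mul_pow_le {A : Type*} [NormedRing A] (R S : A) {ρ : ℝ≥0∞}
    (hS : ∀ r : NNReal, ρ < r → ∃ M : ℝ, 0 ≤ M ∧ ∀ n : ℕ, ‖S ^ n‖ ≤ M * (r : ℝ) ^ n) (k : ℕ)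
    {r : NNReal} (hr : ρ < r) :
    ∃ M : ℝ, 0 ≤ M ∧ ∀ n m : ℕ, ‖wordSum R S k n * S ^ m‖ ≤ M * (r : ℝ) ^ (n + m) := by
  induction k generalizing r with
  | zero =>
    obtain ⟨M, hM, h⟩ := hS r hr
    refine ⟨M, hM, fun n m => ?_⟩
    rw [wordSum, ← pow_add]
    exact h _
  | succ k ih =>
    obtain ⟨r', h1, h2⟩ := ENNReal.lt_iff_exists_nnreal_btwn.1 hr
    have h2' : (r' : ℝ) < r := by exact_mod_cast h2
    have hr0 : (0 : ℝ) < r' := by exact_mod_cast ENNReal.coe_pos.1 (bot_le.trans_lt h1)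
    obtain ⟨M, hM, hk⟩ := ih h1
    obtain ⟨M', hM', hm⟩ := hS r' h1
    obtain ⟨L, hL, hLr⟩ := exists_mul_pow_le hr0.le h2'
    -- The letter `R` counts in the length but brings no factor `r'`, hence the division.
    set c : ℝ := M * ‖R‖ * M' / r'
    have hc : 0 ≤ c := by positivity
    have key : ∀ n m : ℕ, ‖wordSum R S (k + 1) n * S ^ m‖ ≤ n * c * (r' : ℝ) ^ (n + m) := by
      intro n
      induction n with
      | zero => simp [wordSum]
      | succ n ihn =>
        intro m
        have e : wordSum R S (k + 1) (n + 1) * S ^ m =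
            wordSum R S (k + 1) n * S ^ (m + 1) + wordSum R S k n * R * S ^ m := by
          rw [wordSum, add_mul, mul_assoc, ← pow_succ']
        have b1 := ihn (m + 1)
        have b2 : ‖wordSum R S k n * R * S ^ m‖ ≤ c * (r' : ℝ) ^ (n + (m + 1)) := by
          have hk0 := hk n 0
          rw [pow_zero, mul_one, add_zero] at hk0
          calc ‖wordSum R S k n * R * S ^ m‖ ≤ ‖wordSum R S k n‖ * ‖R‖ * ‖S ^ m‖ :=
                (norm_mul_le _ _).trans
                  (mul_le_mul_of_nonneg_right (norm_mul_le _ _) (norm_nonneg _))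
            _ ≤ (M * (r' : ℝ) ^ n) * ‖R‖ * (M' * (r' : ℝ) ^ m) := by
                have := hm m
                gcongr
            _ = c * (r' : ℝ) ^ (n + (m + 1)) := by
                simp only [c, pow_add, pow_one]
                field_simp
        rw [e, add_right_comm n 1 m, add_assoc n m 1]
        refine (norm_add_le _ _).trans ((add_le_add b1 b2).trans_eq ?_)
        push_cast
        ring
    refine ⟨c * L, by positivity, fun n m => (key n m).trans ?_⟩
    calc n * c * (r' : ℝ) ^ (n + m) = c * (n * (r' : ℝ) ^ (n + m)) := by ring
      _ ≤ c * (L * (r : ℝ) ^ (n + m)) := mul_le_mul_of_nonneg_left (hLr n m) hc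
      _ = c * L * (r : ℝ) ^ (n + m) := by ring

end Words

/-! ### Compactness of words with at least three factors `R`. -/

section Domination

variable {B : Type*} [NormedAddCommGroup B] [NormedSpace ℝ B] [Lattice B]

/-- `S` is positive and dominated by a compact operator. -/
def IsCompactlyDominated (S : B →L[ℝ] B) : Prop :=
  ∃ T : B →L[ℝ] B, IsCompactOperator T ∧ ∀ f, 0 ≤ f → 0 ≤ S f ∧ S f ≤ T f

theorem IsCompactlyDominated.zero : IsCompactlyDominated (0 : B →L[ℝ] B) :=
  ⟨0, isCompactOperator_zero, fun _ _ => ⟨le_rfl, le_rfl⟩⟩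

theorem IsCompactlyDominated.mul_right {S U : B →L[ℝ] B} (hS : IsCompactlyDominated S)
    (hU : ∀ f, 0 ≤ f → 0 ≤ U f) : IsCompactlyDominated (S * U) := by
  obtain ⟨T, hT, h⟩ := hS
  exact ⟨T * U, hT.comp_clm U, fun f hf => h _ (hU f hf)⟩

variable [IsOrderedAddMonoid B]

theorem IsCompactlyDominated.add {S S' : B →L[ℝ] B} (hS : IsCompactlyDominated S)
    (hS' : IsCompactlyDominated S') : IsCompactlyDominated (S + S') := by
  obtain ⟨T, hT, h⟩ := hS
  obtain ⟨T', hT', h'⟩ := hS'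
  exact ⟨T + T', hT.add hT', fun f hf =>
    ⟨add_nonneg (h f hf).1 (h' f hf).1, add_le_add (h f hf).2 (h' f hf).2⟩⟩

theorem clm_mono_of_nonneg {U : B →L[ℝ] B} (hU : ∀ f, 0 ≤ f → 0 ≤ U f) {x y : B} (h : x ≤ y) :
    U x ≤ U y := by
  have := hU _ (sub_nonneg.2 h)
  rwa [map_sub, sub_nonneg] at this

theorem IsCompactlyDominated.mul_left {S U : B →L[ℝ] B} (hS : IsCompactlyDominated S)
    (hU : ∀ f, 0 ≤ f → 0 ≤ U f) : IsCompactlyDominated (U * S) := by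
  obtain ⟨T, hT, h⟩ := hS
  exact ⟨U * T, hT.clm_comp U, fun f hf => ⟨hU _ (h f hf).1, clm_mono_of_nonneg hU (h f hf).2⟩⟩

omit [IsOrderedAddMonoid B] in
theorem pow_apply_nonneg {S : B →L[ℝ] B} (hS : ∀ f, 0 ≤ f → 0 ≤ S f) (n : ℕ) {f : B}
    (hf : 0 ≤ f) : 0 ≤ (S ^ n) f := by
  induction n generalizing f with
  | zero => exact hf
  | succ n ih =>
    rw [pow_succ]
    exact ih (hS f hf)

theorem pow_apply_le {S T : B →L[ℝ] B} (hST : ∀ f, 0 ≤ f → 0 ≤ S f ∧ S f ≤ T f) (n : ℕ) {f : B}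
    (hf : 0 ≤ f) : (S ^ n) f ≤ (T ^ n) f := by
  induction n generalizing f with
  | zero => exact le_rfl
  | succ n ih =>
    rw [pow_succ, pow_succ]
    exact (clm_mono_of_nonneg (fun g hg => pow_apply_nonneg (fun f hf => (hST f hf).1) n hg)
      (hST f hf).2).trans (ih ((hST f hf).1.trans (hST f hf).2))

theorem IsCompactlyDominated.wordSum_one {R S : B →L[ℝ] B} (hR : IsCompactlyDominated R)
    (hS : ∀ f, 0 ≤ f → 0 ≤ S f) (n : ℕ) : IsCompactlyDominated (wordSum R S 1 n) := by
  induction n with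
  | zero => exact .zero
  | succ n ih =>
    rw [wordSum]
    exact (ih.mul_right hS).add (hR.mul_left fun f hf => by
      rw [wordSum]
      exact pow_apply_nonneg hS n hf)

variable [IsOrderedModule ℝ B] [HasSolidNorm B]

omit [IsOrderedModule ℝ B] in
theorem norm_pow_le_norm_pow_of_dominated {S T : B →L[ℝ] B}
    (hST : ∀ f, 0 ≤ f → 0 ≤ S f ∧ S f ≤ T f) (n : ℕ) : ‖S ^ n‖ ≤ ‖T ^ n‖ := by
  refine ContinuousLinearMap.opNorm_le_bound _ (norm_nonneg _) fun x => ?_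
  refine (norm_map_le_of_dominated (fun f hf =>
    ⟨pow_apply_nonneg (fun f hf => (hST f hf).1) n hf, pow_apply_le hST n hf⟩) x).trans ?_
  exact ((T ^ n).le_opNorm _).trans_eq (by rw [norm_abs_eq_norm])

variable [CompleteSpace B]

/-- Peel off the last letter of the word: `S` is absorbed into `X`, while `R` leaves `wordSum R S 1
n * R * X`, a product of three operators dominated by compact ones. -/
theorem IsCompactlyDominated.isCompactOperator_wordSum_two_mul {R S X : B →L[ℝ] B}
    (hR : IsCompactlyDominated R) (hS : ∀ f, 0 ≤ f → 0 ≤ S f) (hX : IsCompactlyDominated X)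
    (n : ℕ) : IsCompactOperator (wordSum R S 2 n * X) := by
  induction n generalizing X with
  | zero =>
    rw [wordSum, zero_mul]
    exact isCompactOperator_zero
  | succ n ih =>
    rw [wordSum, add_mul, mul_assoc]
    obtain ⟨T₁, hT₁, h₁⟩ := hX
    obtain ⟨T₂, hT₂, h₂⟩ := hR
    obtain ⟨T₃, hT₃, h₃⟩ := IsCompactlyDominated.wordSum_one ⟨T₂, hT₂, h₂⟩ hS n
    exact (ih (IsCompactlyDominated.mul_left ⟨T₁, hT₁, h₁⟩ hS)).add
      (isCompactOperator_mul_mul_of_dominated h₁ h₂ h₃ hT₁ hT₂ hT₃)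

/-- The words with at least three factors `R` in the expansion of `(R + S) ^ n` are compact. -/
theorem IsCompactlyDominated.isCompactOperator_add_pow_sub {R S : B →L[ℝ] B}
    (hR : IsCompactlyDominated R) (hS : ∀ f, 0 ≤ f → 0 ≤ S f) (n : ℕ) :
    IsCompactOperator
      ((R + S) ^ n - (wordSum R S 0 n + wordSum R S 1 n + wordSum R S 2 n)) := by
  induction n with
  | zero =>
    simp only [wordSum, pow_zero, add_zero, sub_self]
    exact isCompactOperator_zero
  | succ n ih =>
    -- A word acquires its third `R` exactly when `R` is appended to a word with two.
    have e : (R + S) ^ (n + 1) -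
        (wordSum R S 0 (n + 1) + wordSum R S 1 (n + 1) + wordSum R S 2 (n + 1)) =
        ((R + S) ^ n - (wordSum R S 0 n + wordSum R S 1 n + wordSum R S 2 n)) * (R + S) +
          wordSum R S 2 n * R := by
      simp only [wordSum, pow_succ]
      noncomm_ring
    rw [e]
    exact (ih.comp_clm (R + S)).add (hR.isCompactOperator_wordSum_two_mul hS hR n)

/-- Modulo compact operators only words with at most two factors `R` survive, and domination carries
the growth rate of `T ^ n` over to `S ^ n`. -/
theorem essentialSpectralRadius_add_le {R S T : B →L[ℝ] B} (hR : IsCompactlyDominated R)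
    (hST : ∀ f, 0 ≤ f → 0 ≤ S f ∧ S f ≤ T f) :
    essentialSpectralRadius (R + S) ≤ specRadius T := by
  refine le_of_forall_gt fun q hq => ?_
  obtain ⟨r, hr, hrq⟩ := ENNReal.lt_iff_exists_nnreal_btwn.1 hq
  refine lt_of_le_of_lt ?_ hrq
  have hS : ∀ r : NNReal, specRadius T < r →
      ∃ M : ℝ, 0 ≤ M ∧ ∀ n : ℕ, ‖S ^ n‖ ≤ M * (r : ℝ) ^ n := fun r hr => by
    obtain ⟨M, hM, h⟩ := exists_norm_pow_le_of_specRadius_lt T hr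
    exact ⟨M, hM, fun n => (norm_pow_le_norm_pow_of_dominated hST n).trans (h n)⟩
  obtain ⟨M₀, -, h₀⟩ := exists_norm_wordSum_mul_pow_le R S hS 0 hr
  obtain ⟨M₁, -, h₁⟩ := exists_norm_wordSum_mul_pow_le R S hS 1 hr
  obtain ⟨M₂, -, h₂⟩ := exists_norm_wordSum_mul_pow_le R S hS 2 hr
  refine essentialSpectralRadius_le (M := M₀ + M₁ + M₂) fun n =>
    ⟨_, hR.isCompactOperator_add_pow_sub (fun f hf => (hST f hf).1) n, ?_⟩
  have b₀ := h₀ n 0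
  have b₁ := h₁ n 0
  have b₂ := h₂ n 0
  rw [pow_zero, mul_one, add_zero] at b₀ b₁ b₂
  rw [sub_sub_cancel, add_mul, add_mul]
  exact norm_add₃_le.trans (add_le_add (add_le_add b₀ b₁) b₂)

end Domination

end BanachLatticeOperators

open BanachLatticeOperators in
theorem mainTheorem1 {B : Type*} [NormedAddCommGroup B] [NormedSpace ℝ B] [CompleteSpace B]
    [Lattice B] [IsOrderedAddMonoid B] [IsOrderedModule ℝ B] [HasSolidNorm B]
    (P K S : B →ₚ[ℝ] B) (hK : IsCompactOperator K)
    (hpos : PositivePartWellDefined (toBounded P - toBounded S))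
    (hdom : ∀ f : B, 0 ≤ f → 0 ≤ P f ∧ P f ≤ K f + S f) :
    essentialSpectralRadius (toBounded P) ≤ specRadius (toBounded S) ∧
      (specRadius (toBounded S) < specRadius (toBounded P) → IsQuasiCompact (toBounded P)) := by
  have main : essentialSpectralRadius (toBounded P) ≤ specRadius (toBounded S) := by
    obtain ⟨R, hR⟩ := hpos
    have hP0 : ∀ f, 0 ≤ f → 0 ≤ P f := fun f hf => P.map_nonneg hf
    have hK0 : ∀ f, 0 ≤ f → 0 ≤ K f := fun f hf => K.map_nonneg hf
    have hS0 : ∀ f, 0 ≤ f → 0 ≤ S f := fun f hf => S.map_nonneg hf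
    have hRK : ∀ f, 0 ≤ f → R f ≤ K f := fun f hf => (hR f hf).2 <| by
      rintro _ ⟨g, hg, hgf, rfl⟩
      exact (sub_le_iff_le_add.2 (hdom g hg).2).trans (OrderHomClass.mono K hgf)
    have hRP : ∀ f, 0 ≤ f → R f ≤ P f := fun f hf => (hR f hf).2 <| by
      rintro _ ⟨g, hg, hgf, rfl⟩
      exact (sub_le_self _ (hS0 g hg)).trans (OrderHomClass.mono P hgf)
    have hPS : ∀ f, 0 ≤ f → P f - S f ≤ R f := fun f hf => (hR f hf).1 ⟨f, hf, le_rfl, rfl⟩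
    have hdomR : IsCompactlyDominated (toBounded R) :=
      ⟨toBounded K, hK, fun f hf => ⟨R.map_nonneg hf, hRK f hf⟩⟩
    -- Here `P = R + (P - R)`, and `P - R ≤ S` because `P f - S f ≤ R f`.
    have h := essentialSpectralRadius_add_le hdomR (S := toBounded P - toBounded R)
      (T := toBounded S) fun f hf =>
        ⟨sub_nonneg.2 (hRP f hf), sub_le_comm.1 (hPS f hf)⟩
    rwa [add_sub_cancel] at h
  exact ⟨main, fun h => main.trans_lt h⟩
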